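/- Let $R$ be a (finite, simple) connected graph on $r$ vertices. For a finite simple graph $G$ with diagonal degree matrix $D(G)$ and adjacency matrix $A(G)$, put $A_\alpha(G)=\alpha D(G)+(1-\alpha)A(G)$. Let $d\ge 1$ and $k\ge 2$ be integers, and let $B(d,k)$ be the Bethe tree: the rooted tree with $k$ levels (the level of a vertex is one more than its distance from the root) in which the root has degree $d$, the vertices at level $j$ ($2\le j\le k-1$) have degree $d+1$, and the vertices at level $k$ have degree $1$. Let $R\{B(d,k)\}$ be the graph obtained from $R$ and $r$ copies of $B(d,k)$ by identifying the root of the $i$-th copy with the $i$-th vertex of $R$. Let $\alpha\in[0,1)$, $\beta=1-\alpha$, and let $\rho_1(\alpha),\ldots,\rho_r(\alpha)$ be the eigenvalues of $A_\alpha(R)$, listed with multiplicity, where $\rho_1(\alpha)$ is the spectral radius of $A_\alpha(R)$. For $1\le j\le k$ let $T_j$ be the leading principal submatrix of order $j$ of the $k\times k$ symmetric tridiagonal matrix $T_k$ with diagonal entries $\alpha,\alpha(d+1),\ldots,\alpha(d+1),\alpha d$ and with all codiagonal entries equal to $\beta\sqrt d$. For $1\le i\le r$ let $S_i$ be the $k\times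 k$ symmetric tridiagonal matrix with diagonal entries $\alpha,\alpha(d+1),\ldots,\alpha(d+1),\alpha d+\rho_i(\alpha)$ and with all codiagonal entries equal to $\beta\sqrt d$. (For $k=2$ the diagonals are $\alpha,\alpha d$ and $\alpha,\alpha d+\rho_i(\alpha)$.) Then: 1. If $d\ge 2$, then, as sets, $$\mathrm{Spec}(A_\alpha(R\{B(d,k)\}))=\Bigl(\bigcup_{j=1}^{k-1}\mathrm{Spec}(T_j)\Bigr)\cup\Bigl(\bigcup_{i=1}^{r}\mathrm{Spec}(S_i)\Bigr);$$ if $d=1$, then $\mathrm{Spec}(A_\alpha(R\{B(1,k)\}))=\bigcup_{i=1}^{r}\mathrm{Spec}(S_i)$. 2. The eigenvalues of each $T_j$ ($1\le j\le k-1$) and of each $S_i$ ($1\le i\le r$) are simple. As an eigenvalue of $A_\alpha(R\{B(d,k)\})$, each eigenvalue of $T_j$ ($1\le j\le k-1$) counts with multiplicity $r\,d^{\,k-j-1}(d-1)$ and each eigenvalue of $S_i$ counts with multiplicity $1$; if eigenvalues obtained from different matrices are equal, their multiplicities are added. That is, for every real $x$ the multiplicity of $x$ as an eigenvalue of $A_\alpha(R\{B(d,k)\})$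 is $$\sum_{j=1}^{k-1} r\,d^{\,k-j-1}(d-1)\,m_{T_j}(x)+\sum_{i=1}^{r}m_{S_i}(x),$$ where $m_M(x)$ denotes the multiplicity of $x$ as an eigenvalue of $M$ ($0$ if $x$ is not an eigenvalue of $M$). 3. The largest eigenvalue of $S_1$ is the spectral radius of $A_\alpha(R\{B(d,k)\})$. -/

import Mathlib

namespace BetheCopies

/-- The matrix `A_α(G) = α D(G) + (1 - α) A(G)`. -/
noncomputable def aAlpha {V : Type*} [Fintype V] [DecidableEq V] (α : ℝ)
    (G : SimpleGraph V) [DecidableRel G.Adj] : Matrix V V ℝ :=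
  α • Matrix.diagonal (fun v => (G.degree v : ℝ)) + (1 - α) • G.adjMatrix ℝ

/-- The graph `R{H}`: one copy of the rooted graph `(H, o)` for every vertex of `R`, the root of
the copy belonging to `v` being identified with `v`. The vertex `w` of the copy at `v` is `(v, w)`,
so `(v, o)` plays the role of the vertex `v` of `R`. -/
def rootedCopies {V W : Type*} (R : SimpleGraph V) (H : SimpleGraph W) (o : W) :
    SimpleGraph (V × W) where
  Adj x y := (x.1 = y.1 ∧ H.Adj x.2 y.2) ∨ (x.2 = o ∧ y.2 = o ∧ R.Adj x.1 y.1)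
  symm := ⟨by
    rintro x y (⟨h, h'⟩ | ⟨h, h', h''⟩)
    · exact Or.inl ⟨h.symm, h'.symm⟩
    · exact Or.inr ⟨h', h, h''.symm⟩⟩
  loopless := ⟨by
    rintro x (⟨_, h⟩ | ⟨_, _, h⟩)
    · exact H.loopless.irrefl _ h
    · exact R.loopless.irrefl _ h⟩

instance {V W : Type*} [DecidableEq V] [DecidableEq W] (R : SimpleGraph V) (H : SimpleGraph W)
    (o : W) [DecidableRel R.Adj] [DecidableRel H.Adj] : DecidableRel (rootedCopies R H o).Adj :=
  fun x y => inferInstanceAs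
    (Decidable ((x.1 = y.1 ∧ H.Adj x.2 y.2) ∨ (x.2 = o ∧ y.2 = o ∧ R.Adj x.1 y.1)))

/-- The level of a vertex of a rooted graph: one more than its distance from the root. -/
noncomputable def level {W : Type*} (H : SimpleGraph W) (o w : W) : ℕ := H.dist o w + 1

/-- `(H, o)` is a Bethe tree `B(d, k)`: a rooted tree of `k` levels in which the root has
degree `d`, the vertices at the levels `2, …, k - 1` have degree `d + 1`, and the vertices at
level `k` have degree `1`. (These conditions force `1 ≤ d` and `2 ≤ k`.) -/
structure IsBetheTree {W : Type*} [Fintype W] (H : SimpleGraph W) [DecidableRel H.Adj]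
    (o : W) (d k : ℕ) : Prop where
  isTree : H.IsTree
  level_le : ∀ w, level H o w ≤ k
  exists_level_eq : ∃ w, level H o w = k
  degree_root : H.degree o = d
  degree_of_mid : ∀ w, 2 ≤ level H o w → level H o w < k → H.degree w = d + 1
  degree_of_last : ∀ w, level H o w = k → H.degree w = 1

/-- Entries, with rows and columns numbered from `0`, of the `k × k` symmetric tridiagonal matrix
with diagonal `α, α (d + 1), …, α (d + 1), α d + c` and constant codiagonal `(1 - α) √d`
(for `2 ≤ k`). -/
noncomputable def entry (α : ℝ) (d k : ℕ) (c : ℝ) (a b : ℕ) : ℝ :=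
  if a = b then
    if a = 0 then α else if a + 1 = k then α * d + c else α * (d + 1)
  else if a + 1 = b ∨ b + 1 = a then (1 - α) * Real.sqrt d
  else 0

/-- The leading principal submatrix `T_j`, of order `j ≤ k`, of the `k × k` matrix `T_k`. -/
noncomputable def matT (α : ℝ) (d k j : ℕ) : Matrix (Fin j) (Fin j) ℝ :=
  Matrix.of fun a b => entry α d k 0 a b

/-- The `k × k` matrix obtained from `T_k` by adding `ρ` to the last diagonal entry. -/
noncomputable def matS (α : ℝ) (d k : ℕ) (ρ : ℝ) : Matrix (Fin k) (Fin k) ℝ :=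
  Matrix.of fun a b => entry α d k ρ a b

/-- The (algebraic) multiplicity of `x` as an eigenvalue of `M`; it is `0` if `x` is not an
eigenvalue. -/
noncomputable def mult {n : Type*} [Fintype n] [DecidableEq n] (M : Matrix n n ℝ) (x : ℝ) : ℕ :=
  M.charpoly.rootMultiplicity x

end BetheCopies

/-! Every vertex of `R` carries the same tree, so `A_α(R{H}) = 1 ⊗ A_α(H) + A_α(R) ⊗ E`, where `E`
is the matrix unit at the root `o`. Diagonalising `A_α(R)` splits this into the blocks `A_α(H) + ρ_i
E` (`charpoly_aAlpha_rootedCopies`), so only a Bethe tree with a shifted root entry remains.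

On that tree, eliminate from the leaves to the root. By symmetry the pivot at a vertex depends only
on its level, and `d` equal children contribute `d β² / δ`, which is what one neighbour contributes
in a tridiagonal matrix with codiagonal `β √d`. The pivots are therefore those of `x - S_i`, each
repeated as often as its level has vertices. Regrouping them into leading principal minors gives
`det (x - S_i)` times powers of the `det (x - T_j)` (`charpoly_rootShift`), hence all multiplicities
and the spectrum.

Simplicity holds because an eigenvector of a tridiagonal matrix with nonzero codiagonal is
determined by its first entry. For the spectral radius, every `T_j` and `S_i` is dominated entrywise
in absolute value by a principal submatrix of `S_1`, so a Rayleigh quotient bounds all eigenvalues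
by the largest one of `S_1`. -/

namespace BetheCopies

open Matrix Polynomial

/-! ### Determinants by elimination along a forest -/

/-- A square matrix over a field that is the sum of the identity and a part that strictly decreases
a rank function has determinant one. -/
theorem det_one_add_of_rank {n K : Type*} [Fintype n] [DecidableEq n] [Field K]
    (C : Matrix n n K) (ht : n → ℕ) (hC : ∀ a b, C a b ≠ 0 → ht b < ht a) :
    (1 + C).det = 1 := by
  have htri : (1 + C).BlockTriangular (fun a => OrderDual.toDual (ht a)) := by
    intro a b hab
    have hlt : ht a < ht b := hab
    have hne : a ≠ b := by rintro rfl; exact lt_irrefl _ hlt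
    have h0 : C a b = 0 := by
      by_contra h
      exact absurd (hC a b h) (by omega)
    simp [Matrix.one_apply_ne hne, h0]
  rw [htri.det]
  refine Finset.prod_eq_one fun a _ => ?_
  have : (1 + C).toSquareBlock (fun a => OrderDual.toDual (ht a)) a = 1 := by
    ext ⟨i, hi⟩ ⟨j, hj⟩
    have h0 : C i j = 0 := by
      by_contra h
      have h1 := hC i j h
      have h2 : ht i = ht j := OrderDual.toDual.injective (hi.trans hj.symm)
      omega
    simp [Matrix.toSquareBlock, Matrix.toSquareBlockProp, Matrix.one_apply, h0]
  rw [this, Matrix.det_one]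

/-- Gaussian elimination along a forest. The relation `par c a` says that `a` is the parent of
`c`; the matrix is supported on the diagonal and on parent-child pairs, with entries `e`, and the
`δ a` are the pivots obtained by eliminating the children before their parents. -/
theorem det_forest {n : Type*} [Fintype n] [DecidableEq n]
    (par : n → n → Prop) [DecidableRel par] (ht : n → ℕ)
    (hht : ∀ c a, par c a → ht c < ht a)
    (huniq : ∀ c a a', par c a → par c a' → a = a')
    (δ : n → ℝ) (hδ : ∀ c a, par c a → δ c ≠ 0) (e : ℝ) (M : Matrix n n ℝ)
    (hdiag : ∀ a, M a a = δ a + ∑ c with par c a, e ^ 2 / δ c)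
    (hpar : ∀ c a, par c a → M c a = e ∧ M a c = e)
    (hzero : ∀ a b, a ≠ b → ¬ par a b → ¬ par b a → M a b = 0) :
    M.det = ∏ a, δ a := by
  obtain ⟨C, hC⟩ : ∃ C : Matrix n n ℝ, ∀ a c, C a c = if par c a then e / δ c else 0 :=
    ⟨Matrix.of fun a c => if par c a then e / δ c else 0, fun _ _ => rfl⟩
  have hCd : (1 + C).det = 1 := by
    refine det_one_add_of_rank C ht fun a b h => hht b a ?_
    by_contra h'
    exact h (by simp [hC, h'])
  -- This is the LDLᵀ factorisation. There is no fill-in: `C * diagonal δ * Cᵀ` is diagonal because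
  -- no vertex has two parents.
  have hM : M = (1 + C) * Matrix.diagonal δ * (1 + C)ᵀ := by
    ext a b
    have h1 : ((1 + C) * Matrix.diagonal δ * (1 + C)ᵀ) =
        Matrix.diagonal δ + C * Matrix.diagonal δ + Matrix.diagonal δ * Cᵀ +
          C * Matrix.diagonal δ * Cᵀ := by
      rw [Matrix.transpose_add, Matrix.transpose_one]; noncomm_ring
    have h2 : ∀ a c, (C * Matrix.diagonal δ) a c = if par c a then e else 0 := by
      intro a c
      rw [Matrix.mul_diagonal]
      by_cases h : par c a
      · simp [hC, h, hδ c a h]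
      · simp [hC, h]
    have h3 : (Matrix.diagonal δ * Cᵀ) a b = if par a b then e else 0 := by
      rw [← h2 b a, ← Matrix.transpose_apply (C * _), Matrix.transpose_mul,
        Matrix.diagonal_transpose]
    have h4 : (C * Matrix.diagonal δ * Cᵀ) a b =
        if a = b then ∑ c with par c a, e ^ 2 / δ c else 0 := by
      rw [Matrix.mul_apply]
      simp only [h2, Matrix.transpose_apply, hC]
      split_ifs with hab
      · subst hab
        rw [Finset.sum_filter]
        refine Finset.sum_congr rfl fun c _ => ?_
        split_ifs
        · ring
        · simp
      · refine Finset.sum_eq_zero fun c _ => ?_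
        by_cases hca : par c a
        · by_cases hcb : par c b
          · exact absurd (huniq c a b hca hcb) hab
          · simp [hcb]
        · simp [hca]
    rw [h1]
    simp only [Matrix.add_apply, h2, h3, h4]
    by_cases hab : a = b
    · subst hab
      have : ¬ par a a := fun h => lt_irrefl _ (hht a a h)
      simp [this, hdiag]
    · by_cases hp : par a b
      · have : ¬ par b a := fun h => lt_asymm (hht _ _ h) (hht _ _ hp)
        simp [hab, hp, this, (hpar a b hp).1]
      · by_cases hq : par b a
        · simp [hab, hp, hq, (hpar b a hq).2]
        · simp [hab, hp, hq, hzero a b hab hp hq]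
  rw [hM, Matrix.det_mul, Matrix.det_mul, Matrix.det_transpose, hCd, Matrix.det_diagonal]
  ring

/-! ### Pivots and leading principal minors of the tridiagonal matrices -/

/-- The pivots of `x - S`, where `S` is tridiagonal with entries `entry α d k c`. -/
noncomputable def pivot (α : ℝ) (d k : ℕ) (c x : ℝ) : ℕ → ℝ
  | 0 => x - entry α d k c 0 0
  | i + 1 => x - entry α d k c (i + 1) (i + 1) - (1 - α) ^ 2 * d / pivot α d k c x i

/-- The leading principal submatrix of order `j` of the tridiagonal matrix `entry α d k c`. -/
noncomputable def leading (α : ℝ) (d k : ℕ) (c : ℝ) (j : ℕ) : Matrix (Fin j) (Fin j) ℝ :=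
  Matrix.of fun a b => entry α d k c a b

theorem leading_self (α : ℝ) (d k : ℕ) (c : ℝ) : leading α d k c k = matS α d k c := rfl

theorem leading_of_lt {α : ℝ} {d k : ℕ} {c : ℝ} {j : ℕ} (h : j < k) :
    leading α d k c j = matT α d k j := by
  ext a b
  simp only [leading, matT, Matrix.of_apply, entry]
  have : (a : ℕ) + 1 ≠ k := by omega
  simp [this]

/-- A path is a forest in which `i + 1` is the parent of `i`. The last pivot is never divided by, so
it may vanish. -/
theorem eval_charpoly_leading_eq_prod_pivot (α : ℝ) (d k : ℕ) (c x : ℝ) (j : ℕ)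
    (h : ∀ i, i + 1 < j → pivot α d k c x i ≠ 0) :
    (leading α d k c j).charpoly.eval x = ∏ i ∈ Finset.range j, pivot α d k c x i := by
  rw [Matrix.eval_charpoly, Finset.prod_range]
  refine det_forest (fun a b : Fin j => (a : ℕ) + 1 = b) (fun a => a) (fun c a h => by omega)
    (fun c a a' h h' => by omega) (fun i => pivot α d k c x i) (fun a b hab => h a (by omega))
    (-((1 - α) * √d)) _ ?_ ?_ ?_
  · rintro ⟨a, ha⟩
    have he : (-((1 - α) * √(d : ℝ))) ^ 2 = (1 - α) ^ 2 * d := by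
      rw [neg_sq, mul_pow, Real.sq_sqrt (Nat.cast_nonneg d)]
    cases a with
    | zero => simp [leading, pivot]
    | succ a =>
      have : (Finset.univ.filter fun c : Fin j => (c : ℕ) + 1 = a + 1) = {⟨a, by omega⟩} := by
        ext ⟨b, hb⟩; simp
      simp only [this, Finset.sum_singleton, he]
      simp [leading, pivot]
  · intro a b hab
    have h1 : a ≠ b := by rintro rfl; omega
    have h2 : (a : ℕ) ≠ b := by omega
    simp [leading, entry, hab, h1, h1.symm, h2, h2.symm, Matrix.scalar_apply]
  · intro a b hab h1 h2
    have h3 : (a : ℕ) ≠ b := fun h => hab (Fin.ext h)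
    simp [leading, entry, hab, h1, h2, h3, Matrix.scalar_apply]

/-- The pivots do not vanish where no leading principal minor does. -/
theorem pivot_ne_zero {α : ℝ} {d k : ℕ} {c x : ℝ} {m : ℕ}
    (h : ∀ j, 1 ≤ j → j ≤ m → (leading α d k c j).charpoly.eval x ≠ 0) (i : ℕ) (hi : i < m) :
    pivot α d k c x i ≠ 0 := by
  induction i using Nat.strong_induction_on with
  | _ i ih =>
    have h1 := h (i + 1) (by omega) (by omega)
    rw [eval_charpoly_leading_eq_prod_pivot _ _ _ _ _ _ fun l hl => ih l (by omega) (by omega),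
      Finset.prod_range_succ] at h1
    exact right_ne_zero_of_mul h1

/-- The factor `f i` occurs in the partial products with `j > i`, and `d ^ (n - i) = 1 + ∑ d ^ (n -
j) * (d - 1)` over `i < j ≤ n` by telescoping. This turns pivots weighted by level sizes into
leading minors, and is the source of the multiplicities. -/
theorem prod_range_pow_eq (f : ℕ → ℝ) (d n : ℕ) (hd : 1 ≤ d) :
    ∏ i ∈ Finset.range (n + 1), f i ^ d ^ (n - i) =
      (∏ i ∈ Finset.range (n + 1), f i) *
        ∏ j ∈ Finset.Icc 1 n, (∏ i ∈ Finset.range j, f i) ^ (d ^ (n - j) * (d - 1)) := by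
  obtain ⟨e, rfl⟩ : ∃ e, d = e + 1 := ⟨d - 1, by omega⟩
  induction n with
  | zero => simp
  | succ n ih =>
    rw [Finset.prod_range_succ, Finset.prod_range_succ _ (n + 1),
      Finset.prod_Icc_succ_top (by omega : 1 ≤ n + 1)]
    have h1 : ∏ i ∈ Finset.range (n + 1), f i ^ (e + 1) ^ (n + 1 - i) =
        (∏ i ∈ Finset.range (n + 1), f i ^ (e + 1) ^ (n - i)) ^ (e + 1) := by
      rw [← Finset.prod_pow]
      refine Finset.prod_congr rfl fun i hi => ?_
      rw [← pow_mul, ← pow_succ]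
      congr 2
      have := Finset.mem_range.1 hi
      omega
    have h2 : ∏ j ∈ Finset.Icc 1 n, (∏ i ∈ Finset.range j, f i) ^ ((e + 1) ^ (n + 1 - j) * (e + 1 - 1))
        = (∏ j ∈ Finset.Icc 1 n,
          (∏ i ∈ Finset.range j, f i) ^ ((e + 1) ^ (n - j) * (e + 1 - 1))) ^ (e + 1) := by
      rw [← Finset.prod_pow]
      refine Finset.prod_congr rfl fun j hj => ?_
      rw [← pow_mul]
      have := (Finset.mem_Icc.1 hj).2
      rw [show n + 1 - j = (n - j) + 1 by omega, pow_succ]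
      congr 1
      ring
    rw [h1, h2, ih]
    simp only [Nat.sub_self, pow_zero, pow_one, one_mul, Nat.add_sub_cancel, mul_pow]
    rw [pow_succ (∏ i ∈ Finset.range (n + 1), f i) e]
    ring

/-! ### Bethe trees and their characteristic polynomials -/

section Tree

variable {W : Type*} {H : SimpleGraph W} {o : W}

/-- In a tree, a vertex has at most one neighbour that is closer to the root. -/
theorem eq_of_adj_of_dist_eq (hH : H.IsTree) {c a a' : W}
    (ha : H.Adj c a) (hd : H.dist o c = H.dist o a + 1)
    (ha' : H.Adj c a') (hd' : H.dist o c = H.dist o a' + 1) : a = a' := by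
  obtain ⟨p, hp, hpl⟩ := hH.1.exists_path_of_dist o a
  obtain ⟨p', hp', hpl'⟩ := hH.1.exists_path_of_dist o a'
  have h1 : (p.concat ha.symm).IsPath :=
    SimpleGraph.Walk.isPath_of_length_eq_dist _ (by simp [hpl, hd])
  have h2 : (p'.concat ha'.symm).IsPath :=
    SimpleGraph.Walk.isPath_of_length_eq_dist _ (by simp [hpl', hd'])
  have h3 := congrArg Subtype.val ((hH.2.subsingleton_path _ _).elim ⟨_, h1⟩ ⟨_, h2⟩)
  have h4 := congrArg SimpleGraph.Walk.penultimate h3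
  simpa using h4

theorem exists_adj_dist_eq (hH : H.IsTree) {c : W} (hc : c ≠ o) :
    ∃ a, H.Adj c a ∧ H.dist o c = H.dist o a + 1 := by
  obtain ⟨p, hp, hpl⟩ := hH.1.exists_path_of_dist c o
  cases p with
  | nil => exact absurd rfl hc
  | @cons _ a _ h q =>
    refine ⟨a, h, ?_⟩
    rcases hH.dist_eq_dist_add_one_of_adj o h with h1 | h1
    · exact h1
    · have h2 := SimpleGraph.dist_le q
      rw [SimpleGraph.Walk.length_cons, SimpleGraph.dist_comm] at hpl
      rw [SimpleGraph.dist_comm] at h2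
      omega

variable [Fintype W] [DecidableRel H.Adj] {d k : ℕ}

/-- `c` is a child of `a` in the tree `H` with root `o`. -/
def IsChild (H : SimpleGraph W) (o c a : W) : Prop := H.Adj c a ∧ H.dist o c = H.dist o a + 1

noncomputable instance : DecidableRel (IsChild H o) := fun _ _ => Classical.dec _

theorem card_children_root :
    (Finset.univ.filter fun c => IsChild H o c o).card = H.degree o := by
  rw [← SimpleGraph.card_neighborFinset_eq_degree]
  congr 1
  ext c
  simp only [IsChild, Finset.mem_filter, Finset.mem_univ, true_and, SimpleGraph.dist_self,
    SimpleGraph.mem_neighborFinset]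
  exact ⟨fun h => h.1.symm, fun h => ⟨h.symm, SimpleGraph.dist_eq_one_iff_adj.2 h⟩⟩

open Classical in
theorem card_children_add_one (hH : H.IsTree) {a : W} (ha : a ≠ o) :
    (Finset.univ.filter fun c => IsChild H o c a).card + 1 = H.degree a := by
  obtain ⟨p, hp, hd⟩ := exists_adj_dist_eq hH ha
  rw [← SimpleGraph.card_neighborFinset_eq_degree]
  have hn : p ∉ Finset.univ.filter fun c => IsChild H o c a := by
    simp only [Finset.mem_filter, Finset.mem_univ, true_and]
    rintro ⟨-, h⟩
    omega
  rw [← Finset.card_insert_of_notMem hn]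
  congr 1
  ext c
  simp only [Finset.mem_insert, Finset.mem_filter, Finset.mem_univ, true_and,
    SimpleGraph.mem_neighborFinset]
  constructor
  · rintro (rfl | h)
    · exact hp
    · exact h.1.symm
  · intro h
    rcases hH.dist_eq_dist_add_one_of_adj o h with h1 | h1
    · exact Or.inl (eq_of_adj_of_dist_eq hH h h1 hp hd)
    · exact Or.inr ⟨h.symm, h1⟩

theorem IsBetheTree.two_le (hH : IsBetheTree H o d k) : 2 ≤ k := by
  obtain ⟨w, hw⟩ := hH.exists_level_eq
  by_contra hk
  have hk1 : k = 1 := by unfold level at hw; omega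
  have hall : ∀ w, w = o := fun w => by
    have := hH.level_le w
    unfold level at this
    exact (hH.isTree.1.dist_eq_zero_iff.1 (by omega : H.dist o w = 0)).symm
  -- With `k = 1` the root is the only vertex, yet as a vertex of the last level it would need a
  -- neighbour.
  have h1 := hH.degree_of_last o (by simp [level, hk1])
  rw [← SimpleGraph.card_neighborFinset_eq_degree, Finset.card_eq_one] at h1
  obtain ⟨c, hc⟩ := h1
  have : H.Adj o c := by
    rw [← SimpleGraph.mem_neighborFinset, hc]; simp
  exact H.loopless.irrefl o (hall c ▸ this)

theorem IsBetheTree.one_le (hH : IsBetheTree H o d k) : 1 ≤ d := by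
  have hk := hH.two_le
  obtain ⟨w, hw⟩ := hH.exists_level_eq
  have hwo : w ≠ o := by rintro rfl; simp [level] at hw; omega
  have hpos : 0 < H.degree o := by
    have : Nontrivial W := ⟨w, o, hwo⟩
    exact hH.isTree.1.preconnected.degree_pos_of_nontrivial o
  rw [hH.degree_root] at hpos
  exact hpos

theorem IsBetheTree.card_children (hH : IsBetheTree H o d k) {a : W} (ha : H.dist o a + 1 < k) :
    (Finset.univ.filter fun c => IsChild H o c a).card = d := by
  by_cases hao : a = o
  · subst hao
    rw [card_children_root, hH.degree_root]
  · have h1 := card_children_add_one hH.isTree hao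
    have h2 := hH.isTree.1.pos_dist_of_ne (Ne.symm hao)
    rw [hH.degree_of_mid a (by unfold level; omega) ha] at h1
    omega

theorem IsBetheTree.card_children_last (hH : IsBetheTree H o d k) {a : W}
    (ha : H.dist o a + 1 = k) : (Finset.univ.filter fun c => IsChild H o c a) = ∅ := by
  have hk := hH.two_le
  have hao : a ≠ o := by rintro rfl; simp at ha; omega
  have h1 := card_children_add_one hH.isTree hao
  rw [hH.degree_of_last a ha] at h1
  exact Finset.card_eq_zero.1 (by omega)

theorem IsBetheTree.dist_lt (hH : IsBetheTree H o d k) (w : W) : H.dist o w < k :=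
  hH.level_le w

open Classical in
theorem IsBetheTree.card_dist_eq (hH : IsBetheTree H o d k) (n : ℕ) (hn : n < k) :
    (Finset.univ.filter fun w => H.dist o w = n).card = d ^ n := by
  induction n with
  | zero =>
    rw [pow_zero, Finset.card_eq_one]
    refine ⟨o, ?_⟩
    ext w
    simp [hH.isTree.1.dist_eq_zero_iff, eq_comm]
  | succ n ih =>
    have hU : (Finset.univ.filter fun w => H.dist o w = n + 1) =
        (Finset.univ.filter fun w => H.dist o w = n).biUnion
          fun a => Finset.univ.filter fun c => IsChild H o c a := by
      ext w
      simp only [Finset.mem_filter, Finset.mem_univ, true_and, Finset.mem_biUnion]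
      constructor
      · intro hw
        have hwo : w ≠ o := by rintro rfl; simp at hw
        obtain ⟨a, h1, h2⟩ := exists_adj_dist_eq hH.isTree hwo
        exact ⟨a, by omega, h1, h2⟩
      · rintro ⟨a, h1, -, h2⟩
        omega
    rw [hU, Finset.card_biUnion, Finset.sum_congr rfl, Finset.sum_const, ih (by omega), pow_succ,
      smul_eq_mul]
    · intro a ha
      exact hH.card_children (by simp at ha; omega)
    · intro a ha b hb hab
      rw [Function.onFun, Finset.disjoint_left]
      intro c hc hc'
      simp only [Finset.mem_filter, Finset.mem_univ, true_and] at hc hc'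
      exact hab (eq_of_adj_of_dist_eq hH.isTree hc.1 hc.2 hc'.1 hc'.2)

variable [DecidableEq W]

/-- The matrix `A_α(H)` with `c` added to the diagonal entry of the root. -/
noncomputable def rootShift (α : ℝ) (H : SimpleGraph W) [DecidableRel H.Adj] (o : W) (c : ℝ) :
    Matrix W W ℝ :=
  aAlpha α H + c • Matrix.single o o 1

/-- Tridiagonal indices count levels from the bottom: leaves have index `0` and the root has index
`k - 1`. -/
theorem IsBetheTree.rootShift_diag (hH : IsBetheTree H o d k) (α c : ℝ) (a : W) :
    rootShift α H o c a a =
      entry α d k c (k - 1 - H.dist o a) (k - 1 - H.dist o a) := by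
  have hk := hH.two_le
  have hlt := hH.dist_lt a
  have h0 : rootShift α H o c a a = α * H.degree a + if o = a then c else 0 := by
    simp [rootShift, aAlpha, Matrix.single_apply]
  rw [h0]
  by_cases hao : a = o
  · subst hao
    rw [hH.degree_root]
    have h1 : k - 1 ≠ 0 := by omega
    have h2 : k - 1 + 1 = k := by omega
    simp [entry, h1, h2]
  · have h2 := hH.isTree.1.pos_dist_of_ne (Ne.symm hao)
    have h3 : k - 1 - H.dist o a + 1 ≠ k := by omega
    by_cases hl : H.dist o a + 1 = k
    · have h4 : k - 1 - H.dist o a = 0 := by omega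
      rw [hH.degree_of_last a hl]
      simp [entry, h4, Ne.symm hao]
    · have h4 : k - 1 - H.dist o a ≠ 0 := by omega
      rw [hH.degree_of_mid a (by unfold level; omega) (by unfold level; omega)]
      simp [entry, h3, h4, Ne.symm hao]

/-- All children of a vertex share one pivot, so the forest recursion collapses to the tridiagonal
one. Index `i` is attained at the `d ^ (k - 1 - i)` vertices at distance `k - 1 - i` from the root.
-/
theorem IsBetheTree.eval_charpoly_rootShift (hH : IsBetheTree H o d k) (α c x : ℝ)
    (h : ∀ i, i + 1 < k → pivot α d k c x i ≠ 0) :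
    (rootShift α H o c).charpoly.eval x =
      ∏ i ∈ Finset.range k, pivot α d k c x i ^ d ^ (k - 1 - i) := by
  have hk := hH.two_le
  have hdet : (rootShift α H o c).charpoly.eval x =
      ∏ w, pivot α d k c x (k - 1 - H.dist o w) := by
    rw [Matrix.eval_charpoly]
    refine det_forest (IsChild H o) (fun w => k - 1 - H.dist o w) ?_ ?_ _ ?_ (-(1 - α)) _ ?_ ?_ ?_
    · rintro b a ⟨-, hd⟩
      have := hH.dist_lt b
      omega
    · rintro b a a' ⟨h1, h2⟩ ⟨h3, h4⟩
      exact eq_of_adj_of_dist_eq hH.isTree h1 h2 h3 h4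
    · rintro b a ⟨-, hd⟩
      exact h _ (by omega)
    · intro a
      have h1 : (Matrix.scalar W x - rootShift α H o c) a a =
          x - entry α d k c (k - 1 - H.dist o a) (k - 1 - H.dist o a) := by
        rw [Matrix.sub_apply, hH.rootShift_diag]; simp
      rw [h1]
      have hlt := hH.dist_lt a
      by_cases hl : H.dist o a + 1 = k
      · rw [hH.card_children_last hl, show k - 1 - H.dist o a = 0 by omega]
        simp [pivot]
      · obtain ⟨i, hi⟩ : ∃ i, k - 1 - H.dist o a = i + 1 := ⟨k - 2 - H.dist o a, by omega⟩
        have hs : ∑ b with IsChild H o b a,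
            (-(1 - α)) ^ 2 / pivot α d k c x (k - 1 - H.dist o b) =
            d * ((1 - α) ^ 2 / pivot α d k c x i) := by
          rw [← hH.card_children (a := a) (by omega), ← nsmul_eq_mul]
          refine Finset.sum_eq_card_nsmul fun b hb => ?_
          have hb' := (Finset.mem_filter.1 hb).2.2
          rw [neg_sq, show k - 1 - H.dist o b = i by omega]
        rw [hs, hi, pivot]
        ring
    · rintro b a ⟨hadj, -⟩
      have hne := hadj.ne
      have h1 : ∀ u v : W, H.Adj u v →
          (Matrix.scalar W x - rootShift α H o c) u v = -(1 - α) := by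
        intro u v huv
        have h2 : ¬ (o = u ∧ o = v) := by rintro ⟨rfl, rfl⟩; exact huv.ne rfl
        simp [rootShift, aAlpha, huv.ne, huv, Matrix.scalar_apply, h2]
      exact ⟨h1 _ _ hadj, h1 _ _ hadj.symm⟩
    · intro a b hab h1 h2
      have hadj : ¬ H.Adj a b := by
        intro hadj
        rcases hH.isTree.dist_eq_dist_add_one_of_adj o hadj with h3 | h3
        · exact h1 ⟨hadj, h3⟩
        · exact h2 ⟨hadj.symm, h3⟩
      have h2 : ¬ (o = a ∧ o = b) := by rintro ⟨rfl, rfl⟩; exact hab rfl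
      simp [rootShift, aAlpha, hab, hadj, Matrix.scalar_apply, h2]
  rw [hdet, ← Finset.prod_fiberwise_of_maps_to (t := Finset.range k)
    (g := fun w => k - 1 - H.dist o w) (fun w _ => by simp; omega)]
  refine Finset.prod_congr rfl fun i hi => ?_
  have hi' := Finset.mem_range.1 hi
  rw [← hH.card_dist_eq (k - 1 - i) (by omega)]
  have hf : (Finset.univ.filter fun w => k - 1 - H.dist o w = i) =
      Finset.univ.filter fun w => H.dist o w = k - 1 - i := by
    ext w
    have := hH.dist_lt w
    simp only [Finset.mem_filter, Finset.mem_univ, true_and]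
    omega
  rw [hf]
  refine Finset.prod_eq_pow_card fun w hw => ?_
  rw [(Finset.mem_filter.1 hw).2]
  congr 1
  omega

theorem IsBetheTree.charpoly_rootShift (hH : IsBetheTree H o d k) (α c : ℝ) :
    (rootShift α H o c).charpoly = (matS α d k c).charpoly *
      ∏ j ∈ Finset.Icc 1 (k - 1), (matT α d k j).charpoly ^ (d ^ (k - j - 1) * (d - 1)) := by
  have hk := hH.two_le
  set q : ℝ[X] := ∏ j ∈ Finset.Icc 1 (k - 1), (matT α d k j).charpoly with hq
  have hq0 : q ≠ 0 := Finset.prod_ne_zero_iff.2 fun j _ => (Matrix.charpoly_monic _).ne_zero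
  -- It suffices to compare values off the finitely many eigenvalues of the `T_j`, `1 ≤ j ≤ k - 1`,
  -- where every pivot that is divided by is nonzero.
  refine Polynomial.eq_of_infinite_eval_eq _ _ (Set.Infinite.mono ?_
    (q.rootSet_finite ℝ).infinite_compl)
  intro x hx
  have hx' : ∀ j, 1 ≤ j → j ≤ k - 1 → (leading α d k c j).charpoly.eval x ≠ 0 := by
    intro j h1 h2 h3
    refine hx ?_
    rw [Polynomial.mem_rootSet]
    refine ⟨hq0, ?_⟩
    rw [Polynomial.coe_aeval_eq_eval, hq, Polynomial.eval_prod]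
    rw [leading_of_lt (by omega)] at h3
    exact Finset.prod_eq_zero (Finset.mem_Icc.2 ⟨h1, h2⟩) h3
  have hp : ∀ i, i + 1 < k → pivot α d k c x i ≠ 0 :=
    fun i hi => pivot_ne_zero hx' i (by omega)
  rw [Set.mem_ofPred_eq, hH.eval_charpoly_rootShift α c x hp, Polynomial.eval_mul,
    ← leading_self, eval_charpoly_leading_eq_prod_pivot _ _ _ _ _ _ hp, Polynomial.eval_prod]
  obtain ⟨n, rfl⟩ : ∃ n, k = n + 1 := ⟨k - 1, by omega⟩
  simp only [Nat.add_sub_cancel]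
  rw [prod_range_pow_eq _ _ _ hH.one_le]
  congr 1
  refine Finset.prod_congr rfl fun j hj => ?_
  have hj' := Finset.mem_Icc.1 hj
  rw [Polynomial.eval_pow, ← leading_of_lt (c := c) (by omega : j < n + 1),
    eval_charpoly_leading_eq_prod_pivot _ _ _ _ _ _ fun i hi => hp i (by omega),
    show n + 1 - j - 1 = n - j by omega]

end Tree

/-! ### Kronecker decomposition over the copies -/

open scoped Kronecker

theorem aAlpha_isHermitian {V : Type*} [Fintype V] [DecidableEq V] (α : ℝ)
    (G : SimpleGraph V) [DecidableRel G.Adj] : (aAlpha α G).IsHermitian := by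
  ext i j
  by_cases h : i = j
  · simp [aAlpha, h]
  · simp [aAlpha, h, Ne.symm h, SimpleGraph.adj_comm]

theorem charpoly_ne_zero {n : Type*} [Fintype n] [DecidableEq n] (M : Matrix n n ℝ) :
    M.charpoly ≠ 0 :=
  (Matrix.charpoly_monic M).ne_zero

section Copies

variable {V W : Type*} [Fintype V] [DecidableEq V] [Fintype W] [DecidableEq W]
  (R : SimpleGraph V) [DecidableRel R.Adj] (H : SimpleGraph W) [DecidableRel H.Adj] (o : W)

theorem degree_rootedCopies (v : V) (w : W) :
    (rootedCopies R H o).degree (v, w) = H.degree w + if w = o then R.degree v else 0 := by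
  have h1 : (rootedCopies R H o).neighborFinset (v, w) =
      (H.neighborFinset w).map ⟨fun w' => (v, w'), Prod.mk_right_injective v⟩ ∪
        if w = o then (R.neighborFinset v).map ⟨fun v' => (v', o), Prod.mk_left_injective o⟩
        else ∅ := by
    ext ⟨v', w'⟩
    rw [SimpleGraph.mem_neighborFinset]
    split_ifs with hw <;> simp [rootedCopies, hw] <;> tauto
  rw [← SimpleGraph.card_neighborFinset_eq_degree, h1, Finset.card_union_of_disjoint]
  · split_ifs <;> simp
  · rw [Finset.disjoint_left]
    rintro ⟨v', w'⟩ h2 h3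
    split_ifs at h3 with hw
    · simp only [Finset.mem_map, SimpleGraph.mem_neighborFinset, Function.Embedding.coeFn_mk,
        Prod.mk.injEq] at h2 h3
      obtain ⟨_, _, rfl, _⟩ := h2
      obtain ⟨_, h, rfl, _⟩ := h3
      exact R.loopless.irrefl _ h
    · simp at h3

/-- Degrees add at an identified root, so the degree and adjacency parts of `R` together contribute
a full `A_α(R)` at the root coordinate. -/
theorem aAlpha_rootedCopies (α : ℝ) :
    aAlpha α (rootedCopies R H o) =
      (1 : Matrix V V ℝ) ⊗ₖ aAlpha α H + aAlpha α R ⊗ₖ Matrix.single o o (1 : ℝ) := by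
  ext ⟨v, w⟩ ⟨v', w'⟩
  simp only [aAlpha, Matrix.add_apply, Matrix.smul_apply, Matrix.diagonal_apply, Prod.mk.injEq,
    SimpleGraph.adjMatrix_apply, smul_eq_mul, Matrix.kronecker_apply, Matrix.one_apply,
    Matrix.single_apply, degree_rootedCopies]
  by_cases hv : v = v'
  · subst hv
    have h1 : (rootedCopies R H o).Adj (v, w) (v, w') ↔ H.Adj w w' := by simp [rootedCopies]
    by_cases hw : w = w'
    · subst hw
      by_cases ho : w = o
      · simp [ho, mul_add]
      · simp [ho, Ne.symm ho]
    · have h2 : ¬ (o = w ∧ o = w') := by rintro ⟨rfl, rfl⟩; exact hw rfl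
      simp [hw, h1, h2]
  · have h1 : (rootedCopies R H o).Adj (v, w) (v', w') ↔ (o = w ∧ o = w') ∧ R.Adj v v' := by
      simp [rootedCopies, hv, eq_comm, and_assoc]
    simp only [h1]
    by_cases h2 : o = w ∧ o = w' <;> simp [hv, h2, ite_and]

theorem charpoly_kronecker_one_add_kronecker {P : Matrix V V ℝ} (hP : P.IsHermitian)
    (A E : Matrix W W ℝ) :
    ((1 : Matrix V V ℝ) ⊗ₖ A + P ⊗ₖ E).charpoly =
      ∏ v, (A + hP.eigenvalues v • E).charpoly := by
  set U : Matrix V V ℝ := (hP.eigenvectorUnitary : Matrix V V ℝ) with hU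
  have hUU : U * star U = 1 := Unitary.coe_mul_star_self _
  have hUU' : star U * U = 1 := Unitary.coe_star_mul_self _
  have hspec : P = U * Matrix.diagonal hP.eigenvalues * star U := hP.spectral_theorem
  -- Conjugation by `U ⊗ 1` fixes `1 ⊗ A` and diagonalises `P`.
  have hfac : (1 : Matrix V V ℝ) ⊗ₖ A + P ⊗ₖ E = (U ⊗ₖ (1 : Matrix W W ℝ)) *
      (((1 : Matrix V V ℝ) ⊗ₖ A + Matrix.diagonal hP.eigenvalues ⊗ₖ E) *
        (star U ⊗ₖ (1 : Matrix W W ℝ))) := by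
    rw [add_mul, mul_add, ← Matrix.mul_kronecker_mul, ← Matrix.mul_kronecker_mul,
      ← Matrix.mul_kronecker_mul, ← Matrix.mul_kronecker_mul, ← mul_assoc U (Matrix.diagonal _),
      ← hspec]
    simp [hUU]
  have hrev : ((1 : Matrix V V ℝ) ⊗ₖ A + Matrix.diagonal hP.eigenvalues ⊗ₖ E) *
        (star U ⊗ₖ (1 : Matrix W W ℝ)) * (U ⊗ₖ (1 : Matrix W W ℝ)) =
      (1 : Matrix V V ℝ) ⊗ₖ A + Matrix.diagonal hP.eigenvalues ⊗ₖ E := by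
    rw [mul_assoc, ← Matrix.mul_kronecker_mul, hUU']
    simp
  rw [hfac, Matrix.charpoly_mul_comm, hrev]
  refine Polynomial.funext fun x => ?_
  rw [Matrix.eval_charpoly, Polynomial.eval_prod]
  simp only [Matrix.eval_charpoly]
  -- The factors are swapped because `blockDiagonal` keeps the block index in the second coordinate.
  rw [← Matrix.det_blockDiagonal, ← Matrix.det_reindex_self (Equiv.prodComm V W)]
  congr 1
  ext ⟨w, v⟩ ⟨w', v'⟩
  simp only [Matrix.reindex_apply, Matrix.submatrix_apply, Matrix.sub_apply, Matrix.add_apply,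
    Matrix.scalar_apply, Matrix.diagonal_apply, Matrix.kronecker_apply, Matrix.one_apply,
    Matrix.blockDiagonal_apply, Matrix.smul_apply, smul_eq_mul, Equiv.prodComm_symm,
    Equiv.prodComm_apply, Prod.swap_prod_mk, Prod.mk.injEq]
  by_cases hv : v = v' <;> by_cases hw : w = w' <;> simp [hv, hw]

theorem charpoly_aAlpha_rootedCopies (α : ℝ) {ι : Type*} [Fintype ι] (ρ : ι → ℝ)
    (hρ : (aAlpha α R).charpoly.roots = Multiset.map ρ Finset.univ.val) :
    (aAlpha α (rootedCopies R H o)).charpoly = ∏ i, (rootShift α H o (ρ i)).charpoly := by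
  have hP := aAlpha_isHermitian α R
  -- The families `hP.eigenvalues` and `ρ` may be ordered differently; the product only sees the
  -- multiset.
  have h1 : Multiset.map hP.eigenvalues Finset.univ.val = Multiset.map ρ Finset.univ.val := by
    rw [← hρ, hP.roots_charpoly_eq_eigenvalues]
    rfl
  rw [aAlpha_rootedCopies, charpoly_kronecker_one_add_kronecker hP]
  have h2 := congrArg (fun s => (s.map fun c => (rootShift α H o c).charpoly).prod) h1
  simpa only [Multiset.map_map] using! h2

variable {H o}

theorem mult_aAlpha_rootedCopies {d k : ℕ} (hH : IsBetheTree H o d k) (α : ℝ)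
    (ρ : Fin (Fintype.card V) → ℝ)
    (hρ : (aAlpha α R).charpoly.roots = Multiset.map ρ Finset.univ.val) (x : ℝ) :
    mult (aAlpha α (rootedCopies R H o)) x =
      ∑ j ∈ Finset.Icc 1 (k - 1),
        Fintype.card V * d ^ (k - j - 1) * (d - 1) * mult (matT α d k j) x +
      ∑ i, mult (matS α d k (ρ i)) x := by
  have hprod : ∀ {κ : Type} (s : Finset κ) (f : κ → ℝ[X]), (∀ i ∈ s, f i ≠ 0) →
      (∏ i ∈ s, f i).rootMultiplicity x = ∑ i ∈ s, (f i).rootMultiplicity x := by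
    intro κ s f hf
    simp_rw [← Polynomial.count_roots]
    rw [Polynomial.roots_prod f s (Finset.prod_ne_zero_iff.2 hf), Multiset.count_bind]
    rfl
  have h1 : ∀ c, (rootShift α H o c).charpoly.rootMultiplicity x = mult (matS α d k c) x +
      ∑ j ∈ Finset.Icc 1 (k - 1), d ^ (k - j - 1) * (d - 1) * mult (matT α d k j) x := by
    intro c
    have hT : ∀ j ∈ Finset.Icc 1 (k - 1),
        (matT α d k j).charpoly ^ (d ^ (k - j - 1) * (d - 1)) ≠ 0 :=
      fun j _ => pow_ne_zero _ (charpoly_ne_zero _)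
    rw [hH.charpoly_rootShift, Polynomial.rootMultiplicity_mul
      (mul_ne_zero (charpoly_ne_zero _) (Finset.prod_ne_zero_iff.2 hT)), hprod _ _ hT]
    simp only [← Polynomial.count_roots, Polynomial.roots_pow, Multiset.count_nsmul, mult]
  rw [mult, charpoly_aAlpha_rootedCopies R H o α ρ hρ, hprod _ _ fun i _ => charpoly_ne_zero _]
  simp only [h1, Finset.sum_add_distrib, Finset.sum_const, Finset.card_univ, Fintype.card_fin,
    smul_eq_mul, Finset.mul_sum]
  rw [add_comm]
  simp only [mul_assoc]

end Copies

/-! ### Simplicity of the eigenvalues -/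

theorem mem_spectrum_iff_mult_ne_zero {n : Type*} [Fintype n] [DecidableEq n] (M : Matrix n n ℝ)
    (x : ℝ) : x ∈ spectrum ℝ M ↔ mult M x ≠ 0 := by
  rw [Matrix.mem_spectrum_iff_isRoot_charpoly, mult, ← Nat.pos_iff_ne_zero,
    Polynomial.rootMultiplicity_pos (Matrix.charpoly_monic M).ne_zero]

/-- If a Hermitian matrix has a coordinate on which no eigenvector vanishes, its eigenvalues are
simple. -/
theorem mult_eq_one_of_forall_apply_ne_zero {n : Type*} [Fintype n] [DecidableEq n]
    {M : Matrix n n ℝ} (hM : M.IsHermitian) (i₀ : n) {x : ℝ}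
    (h : ∀ v : n → ℝ, M *ᵥ v = x • v → v i₀ = 0 → v = 0) (hx : x ∈ spectrum ℝ M) :
    mult M x = 1 := by
  refine le_antisymm ?_ (Nat.one_le_iff_ne_zero.2 ((mem_spectrum_iff_mult_ne_zero M x).1 hx))
  rw [mult, ← Polynomial.count_roots, hM.roots_charpoly_eq_eigenvalues, Multiset.count_map,
    ← Finset.filter_val, Finset.card_val, Finset.card_le_one]
  intro a ha b hb
  simp only [Finset.mem_filter, Finset.mem_univ, true_and, Function.comp_apply,
    RCLike.ofReal_real_eq_id, id] at ha hb
  by_contra hab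
  set u := hM.eigenvectorBasis a with hu
  set w := hM.eigenvectorBasis b with hw
  have hMu : M *ᵥ u = x • (u : n → ℝ) := by rw [hu, hM.mulVec_eigenvectorBasis, ← ha]
  have hMw : M *ᵥ w = x • (w : n → ℝ) := by rw [hw, hM.mulVec_eigenvectorBasis, ← hb]
  -- This combination of two orthonormal eigenvectors vanishes at `i₀`, hence is zero. Pairing it
  -- with `w` gives `u i₀ = 0`, so `u = 0`, which is absurd.
  have hz : (w i₀ • (u : n → ℝ) - u i₀ • (w : n → ℝ)) = 0 := by
    refine h _ ?_ ?_
    · rw [Matrix.mulVec_sub, Matrix.mulVec_smul, Matrix.mulVec_smul, hMu, hMw, smul_sub,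
        smul_comm x, smul_comm x]
    · simp [mul_comm]
  have hz' : w i₀ • u - u i₀ • w = 0 := by
    ext i
    exact congrFun hz i
  have hin : inner ℝ (w i₀ • u - u i₀ • w) w = -u i₀ := by
    rw [inner_sub_left, inner_smul_left, inner_smul_left, hu, hw,
      hM.eigenvectorBasis.inner_eq_zero hab, hM.eigenvectorBasis.inner_eq_one]
    simp
  rw [hz', inner_zero_left] at hin
  have hu0 : (u : n → ℝ) = 0 := h _ hMu (by linarith)
  have : u = 0 := by ext i; exact congrFun hu0 i
  exact hM.eigenvectorBasis.toBasis.ne_zero a (by simpa [hu] using this)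

theorem leading_isHermitian (α : ℝ) (d k : ℕ) (c : ℝ) (j : ℕ) :
    (leading α d k c j).IsHermitian := by
  ext a b
  simp only [leading, Matrix.conjTranspose_apply, Matrix.of_apply, entry, star_trivial]
  by_cases h : (a : ℕ) = b
  · simp [h]
  · simp [h, Ne.symm h, or_comm]

/-- An eigenvector of a tridiagonal matrix is determined by its first entry. -/
theorem eq_zero_of_leading_mulVec {α : ℝ} (hα : α < 1) {d : ℕ} (hd : 1 ≤ d) (k : ℕ) (c : ℝ)
    {j : ℕ} [NeZero j] {x : ℝ} {v : Fin j → ℝ} (hv : leading α d k c j *ᵥ v = x • v)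
    (h0 : v 0 = 0) : v = 0 := by
  have hb : (1 - α) * √(d : ℝ) ≠ 0 :=
    mul_ne_zero (by linarith) (Real.sqrt_ne_zero'.2 (by exact_mod_cast hd))
  have key : ∀ n (hn : n < j), v ⟨n, hn⟩ = 0 := by
    intro n
    induction n using Nat.strong_induction_on with
    | _ n ih =>
      intro hn
      cases n with
      | zero => exact h0
      | succ n =>
        -- Once the entries up to `n` vanish, row `n` of the eigenvalue equation reads `β √d * v (n
        -- + 1) = 0`.
        have h1 := congrFun hv ⟨n, by omega⟩
        rw [Matrix.mulVec, dotProduct, Finset.sum_eq_single ⟨n + 1, hn⟩] at h1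
        · simp only [leading, Matrix.of_apply, Pi.smul_apply, smul_eq_mul,
            ih n (by omega) (by omega), mul_zero] at h1
          simpa [entry, hb] using h1
        · rintro ⟨b, hbj⟩ - hbn
          have hbn' : b ≠ n + 1 := fun h => hbn (Fin.ext h)
          by_cases hlt : b < n + 1
          · rw [ih b hlt hbj, mul_zero]
          · have h2 : n ≠ b := by omega
            have h3 : n + 1 ≠ b := by omega
            have h4 : b + 1 ≠ n := by omega
            simp [leading, entry, h2, h3, h4]
        · simp
  ext ⟨n, hn⟩
  exact key n hn

theorem mult_leading_eq_one {α : ℝ} (hα : α < 1) {d : ℕ} (hd : 1 ≤ d) (k : ℕ) (c : ℝ)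
    {j : ℕ} (hj : 1 ≤ j) {x : ℝ} (hx : x ∈ spectrum ℝ (leading α d k c j)) :
    mult (leading α d k c j) x = 1 := by
  have : NeZero j := ⟨by omega⟩
  exact mult_eq_one_of_forall_apply_ne_zero (leading_isHermitian α d k c j) 0
    (fun v hv h0 => eq_zero_of_leading_mulVec hα hd k c hv h0) hx

/-! ### Domination and the spectral radius -/

/-- The Rayleigh bound for a Hermitian matrix. -/
theorem dotProduct_mulVec_le {n : Type*} [Fintype n] [DecidableEq n] {M : Matrix n n ℝ}
    (hM : M.IsHermitian) {μ : ℝ} (hμ : ∀ y ∈ spectrum ℝ M, y ≤ μ) (w : n → ℝ) :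
    w ⬝ᵥ M *ᵥ w ≤ μ * (w ⬝ᵥ w) := by
  have hH : (μ • (1 : Matrix n n ℝ) - M).IsHermitian :=
    (Matrix.isHermitian_one.smul (by simp [IsSelfAdjoint])).sub hM
  have hps : (μ • (1 : Matrix n n ℝ) - M).PosSemidef := by
    rw [hH.posSemidef_iff_eigenvalues_nonneg]
    intro i
    have h1 : hH.eigenvalues i ∈ spectrum ℝ (μ • (1 : Matrix n n ℝ) - M) :=
      hH.eigenvalues_mem_spectrum_real i
    generalize hH.eigenvalues i = y at h1 ⊢
    rw [← Algebra.algebraMap_eq_smul_one, spectrum.mem_iff, ← IsUnit.neg_iff] at h1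
    have h2 : μ - y ∈ spectrum ℝ M := by
      rw [spectrum.mem_iff, map_sub]
      convert h1 using 2
      abel
    have := hμ _ h2
    simp only [Pi.zero_apply]
    linarith
  have h3 := hps.dotProduct_mulVec_nonneg w
  rw [Matrix.sub_mulVec, dotProduct_sub, Matrix.smul_mulVec, Matrix.one_mulVec,
    dotProduct_smul] at h3
  simp only [star_trivial, smul_eq_mul] at h3
  linarith

/-- If the entries of `A` are dominated in absolute value by the entries of a principal submatrix
of the Hermitian matrix `M`, then the real eigenvalues of `A` are dominated in absolute value by
the largest eigenvalue of `M`. -/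
theorem abs_le_of_mem_spectrum {m n : Type*} [Fintype m] [DecidableEq m] [Fintype n]
    [DecidableEq n] {A : Matrix m m ℝ} {M : Matrix n n ℝ} (hM : M.IsHermitian) {μ : ℝ}
    (hμ : ∀ y ∈ spectrum ℝ M, y ≤ μ) (f : m → n) (hf : Function.Injective f)
    (hAM : ∀ i j, |A i j| ≤ M (f i) (f j)) {y : ℝ} (hy : y ∈ spectrum ℝ A) : |y| ≤ μ := by
  rw [← Matrix.spectrum_toLin', ← Module.End.hasEigenvalue_iff_mem_spectrum] at hy
  obtain ⟨v, hv⟩ := hy.exists_hasEigenvector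
  have hAv : A *ᵥ v = y • v := by simpa using hv.apply_eq_smul
  -- The test vector for the Rayleigh quotient of `M` is `|v|`, extended by zero outside the
  -- submatrix.
  set w : n → ℝ := Function.extend f (fun i => |v i|) 0 with hw
  have hwf : ∀ i, w (f i) = |v i| := fun i => hf.extend_apply _ _ i
  have hw0 : ∀ b, b ∉ Set.range f → w b = 0 := fun b hb => by
    rw [hw, Function.extend_apply' _ _ _ (by simpa using hb)]; rfl
  have hww : w ⬝ᵥ w = v ⬝ᵥ v := by
    rw [dotProduct, dotProduct]
    refine (Fintype.sum_of_injective f hf _ _ (fun b hb => by simp [hw0 b hb]) fun i => ?_).symm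
    rw [hwf, abs_mul_abs_self]
  have hwM : w ⬝ᵥ M *ᵥ w = ∑ i, |v i| * ∑ j, M (f i) (f j) * |v j| := by
    rw [dotProduct]
    refine (Fintype.sum_of_injective f hf _ _ (fun b hb => by simp [hw0 b hb]) fun i => ?_).symm
    rw [hwf, Matrix.mulVec, dotProduct]
    congr 1
    refine Fintype.sum_of_injective f hf _ _ (fun b hb => by simp [hw0 b hb]) fun j => ?_
    rw [hwf]
  have hpos : 0 < v ⬝ᵥ v := by
    refine lt_of_le_of_ne (Finset.sum_nonneg fun i _ => mul_self_nonneg _) fun h => hv.2 ?_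
    exact dotProduct_self_eq_zero.1 h.symm
  have h1 : |y| * (v ⬝ᵥ v) ≤ w ⬝ᵥ M *ᵥ w := by
    have h2 : y * (v ⬝ᵥ v) = ∑ i, v i * ∑ j, A i j * v j := by
      rw [← smul_eq_mul, ← dotProduct_smul, ← hAv]; rfl
    rw [← abs_of_pos hpos, ← abs_mul, h2, hwM]
    refine (Finset.abs_sum_le_sum_abs _ _).trans (Finset.sum_le_sum fun i _ => ?_)
    rw [abs_mul]
    refine mul_le_mul_of_nonneg_left ?_ (abs_nonneg _)
    refine (Finset.abs_sum_le_sum_abs _ _).trans (Finset.sum_le_sum fun j _ => ?_)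
    rw [abs_mul]
    exact mul_le_mul_of_nonneg_right (hAM i j) (abs_nonneg _)
  have h3 := dotProduct_mulVec_le hM hμ w
  rw [hww] at h3
  exact le_of_mul_le_mul_right (h1.trans h3) hpos

theorem spectralRadius_eq_of_isGreatest_abs {n : Type*} [Fintype n] [DecidableEq n]
    {A : Matrix n n ℝ} {μ : ℝ} (hμ : μ ∈ spectrum ℝ A) (hA : ∀ y ∈ spectrum ℝ A, |y| ≤ μ) :
    spectralRadius ℝ A = ENNReal.ofReal μ := by
  have h0 : 0 ≤ μ := (abs_nonneg _).trans (hA μ hμ)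
  have hnorm : ∀ y : ℝ, (‖y‖₊ : ENNReal) = ENNReal.ofReal |y| := fun y => by
    rw [← Real.norm_eq_abs, ofReal_norm]; rfl
  refine le_antisymm (iSup₂_le fun y hy => ?_) ?_
  · rw [hnorm]
    exact ENNReal.ofReal_le_ofReal (hA y hy)
  · rw [← abs_of_nonneg h0, ← hnorm]
    exact le_iSup₂ (f := fun (y : ℝ) (_ : y ∈ spectrum ℝ A) => (‖y‖₊ : ENNReal)) μ hμ

theorem abs_le_of_spectralRadius_eq {n : Type*} [Fintype n] [DecidableEq n]
    {A : Matrix n n ℝ} {r : ℝ} (hr : r ∈ spectrum ℝ A)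
    (hA : spectralRadius ℝ A = ENNReal.ofReal r) {y : ℝ} (hy : y ∈ spectrum ℝ A) : |y| ≤ r := by
  have hle : ∀ z ∈ spectrum ℝ A, ENNReal.ofReal |z| ≤ ENNReal.ofReal r := fun z hz => by
    rw [← hA, ← Real.norm_eq_abs, ofReal_norm]
    exact le_iSup₂ (f := fun (y : ℝ) (_ : y ∈ spectrum ℝ A) => (‖y‖₊ : ENNReal)) z hz
  -- `ENNReal.ofReal` sends negative numbers to `0`, so the sign of `r` must be recovered: `r < 0`
  -- would make the spectral radius `0` and force the eigenvalue `r` to be `0`.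
  have h0 : 0 ≤ r := by
    by_contra h
    have h1 := hle r hr
    rw [ENNReal.ofReal_of_nonpos (le_of_lt (not_le.1 h)), nonpos_iff_eq_zero,
      ENNReal.ofReal_eq_zero] at h1
    exact h (abs_nonpos_iff.1 h1).ge
  exact (ENNReal.ofReal_le_ofReal_iff h0).1 (hle y hy)

/-- Only the last diagonal entry depends on `c`; the absolute value is needed because some `ρ_i` may
be negative. -/
theorem abs_entry_le {α : ℝ} (hα0 : 0 ≤ α) (hα1 : α < 1) (d k : ℕ) {c c' : ℝ} (hc : |c| ≤ c')
    (a b : ℕ) : |entry α d k c a b| ≤ entry α d k c' a b := by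
  have hd : (0 : ℝ) ≤ d := Nat.cast_nonneg d
  have hαd : 0 ≤ α * d := mul_nonneg hα0 hd
  unfold entry
  split_ifs
  · rw [abs_of_nonneg hα0]
  · calc |α * d + c| ≤ |α * d| + |c| := abs_add_le _ _
      _ ≤ α * d + c' := by rw [abs_of_nonneg hαd]; linarith
  · rw [abs_of_nonneg (by positivity)]
  · rw [abs_of_nonneg (mul_nonneg (by linarith) (Real.sqrt_nonneg _))]
  · simp

theorem abs_le_of_mem_spectrum_leading {α : ℝ} (hα0 : 0 ≤ α) (hα1 : α < 1) (d k : ℕ) {c c' : ℝ}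
    (hc : |c| ≤ c') {μ : ℝ} (hμ : ∀ y ∈ spectrum ℝ (matS α d k c'), y ≤ μ) {j : ℕ} (hj : j ≤ k)
    {y : ℝ} (hy : y ∈ spectrum ℝ (leading α d k c j)) : |y| ≤ μ :=
  abs_le_of_mem_spectrum (leading_isHermitian α d k c' k) hμ (Fin.castLE hj)
    (Fin.castLE_injective hj) (fun a b => abs_entry_le hα0 hα1 d k hc a b) hy

theorem exists_isGreatest_spectrum {n : Type*} [Fintype n] [DecidableEq n] [Nonempty n]
    {M : Matrix n n ℝ} (hM : M.IsHermitian) : ∃ μ, IsGreatest (spectrum ℝ M) μ := by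
  rw [hM.spectrum_real_eq_range_eigenvalues]
  exact (Set.finite_range _).isCompact.exists_isGreatest (Set.range_nonempty _)

end BetheCopies

/-! ### Assembly of the three claims -/

theorem mainTheorem5 {V W : Type*} [Fintype V] [DecidableEq V] [Fintype W] [DecidableEq W]
    (R : SimpleGraph V) [DecidableRel R.Adj] (hR : R.Connected)
    (H : SimpleGraph W) [DecidableRel H.Adj] (o : W) (d k : ℕ)
    (hH : BetheCopies.IsBetheTree H o d k)
    (α : ℝ) (hα0 : 0 ≤ α) (hα1 : α < 1)
    (ρ : Fin (Fintype.card V) → ℝ)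
    (hρ : (BetheCopies.aAlpha α R).charpoly.roots = Multiset.map ρ Finset.univ.val)
    (i₁ : Fin (Fintype.card V))
    (hi₁ : spectralRadius ℝ (BetheCopies.aAlpha α R) = ENNReal.ofReal (ρ i₁)) :
    -- (1) the spectrum as a set
    (2 ≤ d →
      spectrum ℝ (BetheCopies.aAlpha α (BetheCopies.rootedCopies R H o)) =
        (⋃ j ∈ Finset.Icc 1 (k - 1), spectrum ℝ (BetheCopies.matT α d k j)) ∪
          ⋃ i, spectrum ℝ (BetheCopies.matS α d k (ρ i))) ∧
    (d = 1 →
      spectrum ℝ (BetheCopies.aAlpha α (BetheCopies.rootedCopies R H o)) =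
        ⋃ i, spectrum ℝ (BetheCopies.matS α d k (ρ i))) ∧
    -- (2) the eigenvalues of each `T_j` and each `S_i` are simple, and multiplicities add up, an
    -- eigenvalue of `T_j` counting `r d ^ (k - j - 1) (d - 1)` times and one of `S_i` once
    (∀ j ∈ Finset.Icc 1 (k - 1), ∀ x ∈ spectrum ℝ (BetheCopies.matT α d k j),
      BetheCopies.mult (BetheCopies.matT α d k j) x = 1) ∧
    (∀ i, ∀ x ∈ spectrum ℝ (BetheCopies.matS α d k (ρ i)),
      BetheCopies.mult (BetheCopies.matS α d k (ρ i)) x = 1) ∧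
    (∀ x : ℝ,
      BetheCopies.mult (BetheCopies.aAlpha α (BetheCopies.rootedCopies R H o)) x =
        ∑ j ∈ Finset.Icc 1 (k - 1),
          Fintype.card V * d ^ (k - j - 1) * (d - 1) *
            BetheCopies.mult (BetheCopies.matT α d k j) x +
        ∑ i, BetheCopies.mult (BetheCopies.matS α d k (ρ i)) x) ∧
    -- (3) the largest eigenvalue of `S_1` is the spectral radius
    (∃ μ : ℝ, 0 ≤ μ ∧ IsGreatest (spectrum ℝ (BetheCopies.matS α d k (ρ i₁))) μ ∧
      spectralRadius ℝ (BetheCopies.aAlpha α (BetheCopies.rootedCopies R H o)) =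
        ENNReal.ofReal μ) := by
  classical
  have hk := hH.two_le
  have hd := hH.one_le
  have hV : Fintype.card V ≠ 0 := fun h => (Fin.cast h i₁).elim0
  have hmult := BetheCopies.mult_aAlpha_rootedCopies R hH α ρ hρ
  -- The coefficient `r d ^ (k - j - 1) (d - 1)` is nonzero exactly when `d ≥ 2`, so the two cases
  -- of the set equality follow together.
  have hmem : ∀ x, x ∈ spectrum ℝ (BetheCopies.aAlpha α (BetheCopies.rootedCopies R H o)) ↔
      (2 ≤ d ∧ ∃ j ∈ Finset.Icc 1 (k - 1), x ∈ spectrum ℝ (BetheCopies.matT α d k j)) ∨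
        ∃ i, x ∈ spectrum ℝ (BetheCopies.matS α d k (ρ i)) := by
    intro x
    simp only [BetheCopies.mem_spectrum_iff_mult_ne_zero]
    rw [hmult x, Ne, Nat.add_eq_zero_iff, Finset.sum_eq_zero_iff, Finset.sum_eq_zero_iff,
      not_and_or]
    push Not
    refine or_congr ⟨?_, ?_⟩ (by simp)
    · rintro ⟨j, hj, h⟩
      refine ⟨?_, j, hj, right_ne_zero_of_mul h⟩
      have := right_ne_zero_of_mul (left_ne_zero_of_mul h)
      omega
    · rintro ⟨h2, j, hj, h⟩
      exact ⟨j, hj, mul_ne_zero (mul_ne_zero (mul_ne_zero hV (pow_ne_zero _ (by omega)))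
        (by omega)) h⟩
  refine ⟨fun h2 => ?_, fun h1 => ?_, fun j hj x hx => ?_, fun i x hx => ?_, hmult, ?_⟩
  · ext x
    rw [hmem x]
    simp [h2]
  · ext x
    rw [hmem x]
    simp [h1]
  · have hj' := Finset.mem_Icc.1 hj
    rw [← BetheCopies.leading_of_lt (c := 0) (by omega : j < k)] at hx ⊢
    exact BetheCopies.mult_leading_eq_one hα1 hd k 0 hj'.1 hx
  · exact BetheCopies.mult_leading_eq_one hα1 hd k (ρ i) (by omega) hx
  · have hρmem : ∀ i, ρ i ∈ spectrum ℝ (BetheCopies.aAlpha α R) := fun i => by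
      rw [Matrix.mem_spectrum_iff_isRoot_charpoly]
      refine Polynomial.isRoot_of_mem_roots ?_
      rw [hρ]
      exact Multiset.mem_map_of_mem ρ (Finset.mem_univ i)
    have hρle : ∀ i, |ρ i| ≤ ρ i₁ := fun i =>
      BetheCopies.abs_le_of_spectralRadius_eq (hρmem i₁) hi₁ (hρmem i)
    have hne : Nonempty (Fin k) := ⟨⟨0, by omega⟩⟩
    obtain ⟨μ, hμ⟩ := BetheCopies.exists_isGreatest_spectrum
      (BetheCopies.leading_isHermitian α d k (ρ i₁) k)
    have hle : ∀ x ∈ spectrum ℝ (BetheCopies.aAlpha α (BetheCopies.rootedCopies R H o)),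
        |x| ≤ μ := by
      intro x hx
      rcases (hmem x).1 hx with ⟨-, j, hj, hxj⟩ | ⟨i, hi⟩
      · have hj' := Finset.mem_Icc.1 hj
        -- Since `j < k`, `T_j` does not involve the corner entry, so it is also a leading submatrix
        -- of `S_1` itself.
        rw [← BetheCopies.leading_of_lt (c := ρ i₁) (by omega : j < k)] at hxj
        exact BetheCopies.abs_le_of_mem_spectrum_leading hα0 hα1 d k (hρle i₁) hμ.2
          (by omega) hxj
      · exact BetheCopies.abs_le_of_mem_spectrum_leading hα0 hα1 d k (hρle i) hμ.2 le_rfl hi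
    have hμmem := (hmem μ).2 (Or.inr ⟨i₁, hμ.1⟩)
    exact ⟨μ, (abs_nonneg _).trans (hle μ hμmem), hμ,
      BetheCopies.spectralRadius_eq_of_isGreatest_abs hμmem hle⟩
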